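/- Let $R$ be a commutative noetherian ring, $f_1,\dots,f_r\in R$ (with $r\ge 0$), and $M$ a finitely generated $R$-module. For a ring $A$ and an $A$-module $N$, call $g_1,\dots,g_s\in A$ strongly regular on $N$ if, for every $i=1,\dots,s$, multiplication by $g_i$ is injective on $N/(g_1,\dots,g_{i-1})N$ (it is not required that $N\neq(g_1,\dots,g_s)N$). Call $g_1,\dots,g_s$ regular on $N$ if, for every $\mathfrak p\in\operatorname{Supp}_A(N/(g_1,\dots,g_s)N)$, the images of $g_1,\dots,g_s$ in $A_{\mathfrak p}$ are strongly regular on the $A_{\mathfrak p}$-module $N_{\mathfrak p}$. For a non-zero finitely generated module $N$ over a noetherian local ring $(A,\mathfrak m)$, let $\operatorname{depth}_A(N)$ be the maximal length of a regular sequence on $N$ consisting of elements of $\mathfrak m$. Then the following statements are equivalent: (i) $f_1,\dots,f_r$ is a regular sequence on $M$; (ii) $\operatorname{depth}_{R_{\mathfrak p}}(M_{\mathfrak p})\ge r$ for every $\mathfrak p\in\operatorname{Supp}(M/(f_1,\dots,f_r)M)$; (iii) $\operatorname{depth}_{R_{\mathfrak p}}(M_{\mathfrak p})\ge r$ for every $\mathfrak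 p\in\operatorname{Ass}(M/(f_1,\dots,f_r)M)$. (In (ii) and (iii) the module $M_{\mathfrak p}$ is automatically non-zero.) -/

import Mathlib

universe u v

/-- The sequence `f₁, …, f_r` is *strongly regular* on `M`: each `fᵢ` is a non-zero-divisor on
`M / (f₁, …, fᵢ₋₁) M`. It is not required that `M ≠ (f₁, …, f_r) M`, so this is exactly
Mathlib's `IsWeaklyRegular` (and not Mathlib's `IsRegular`). -/
def IsStronglyRegularSeq (R : Type u) [CommRing R] (M : Type v) [AddCommGroup M] [Module R M]
    (f : List R) : Prop :=
  RingTheory.Sequence.IsWeaklyRegular M f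

/-- The sequence `f₁, …, f_r` is *regular* on `M`: for every prime `p` in the support of
`M / (f₁, …, f_r) M`, the sequence of the images of the `fᵢ` in the local ring `R_p` is strongly
regular on the `R_p`-module `M_p`. -/
def IsRegularSeq (R : Type u) [CommRing R] (M : Type v) [AddCommGroup M] [Module R M]
    (f : List R) : Prop :=
  ∀ p : PrimeSpectrum R,
    p ∈ Module.support R (M ⧸ (Ideal.ofList f • ⊤ : Submodule R M)) →
      IsStronglyRegularSeq (Localization.AtPrime p.asIdeal)
        (LocalizedModule p.asIdeal.primeCompl M)
        (f.map (algebraMap R (Localization.AtPrime p.asIdeal)))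

/-- The depth of a module over a local ring: the largest length of a regular sequence on `M` all
of whose terms lie in the maximal ideal. (For a non-zero finitely generated module over a
noetherian local ring all maximal such sequences have the same finite length.) -/
noncomputable def localDepth (R : Type u) [CommRing R] [IsLocalRing R]
    (M : Type v) [AddCommGroup M] [Module R M] : ℕ∞ :=
  sSup {n : ℕ∞ | ∃ f : List R,
    (∀ x ∈ f, x ∈ IsLocalRing.maximalIdeal R) ∧ IsRegularSeq R M f ∧ (f.length : ℕ∞) = n}

/-!
The implications from regularity to the depth bound on the support, and from there to the depth
bound at the associated primes, are formal: localizations of a regular sequence are regular, they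
lie in the maximal ideal at a prime of the support, and associated primes lie in the support.

For the converse one shows that `f` is weakly regular on `M_p` for every prime `p ⊇ (f)`, by
induction on the height of `p` (`isWeaklyRegular_localizedModule_of_le_localDepth`). By induction,
`f` is weakly regular at all points `≠ p` of `Spec R_p` that contain `f`. This reduces the claim to
a local statement (`IsWeaklyRegularOnPunctured.isWeaklyRegular`): over a noetherian local ring
`(R, 𝔪)`, if `f = (x, g)` is weakly regular on the punctured spectrum, and `M` has depth at least
the length of `f` in case `𝔪 ∈ Ass (M / fM)`, then `f` is weakly regular on `M`.

The local statement is proved by induction on the length of `f`.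

* Suppose that `𝔪 ∉ Ass M`. No associated prime of `M` contains `f`, since `x` would be regular on
  the localization there. Prime avoidance in the coset `x + (g)` gives an `M`-regular element `y` with
  `(y, g) = (x, g)` (`IsWeaklyRegularOnPunctured.exists_isSMulRegular`). The hypotheses pass to `g`
  on `M / yM`: away from the closed point because regular sequences over local rings are permutable,
  and for the depth by the criterion of Rees
  (`IsLocalRing.exists_isWeaklyRegular_quotSMulTop`). So `(y, g)`, hence also `(x, g)`, is weakly
  regular.
* If `𝔪 ∈ Ass (M / fM)`, the depth of `M` is positive, so `𝔪 ∉ Ass M`.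
* If `𝔪 ∉ Ass (M / fM)`, let `N ⊆ M` be the submodule of elements killed by a power of `𝔪`. It is
  contained in `fM`, so `M / N` inherits the hypotheses and the first case shows that `f` is weakly
  regular on `M / N`. Then `N / fN` embeds into `M / fM` with image zero, and Nakayama's lemma gives
  `N = 0` (`Submodule.eq_bot_of_isWeaklyRegular_quotient`).
-/

open RingTheory.Sequence IsLocalRing Pointwise
open scoped TensorProduct

/-! ### Prime avoidance in cosets -/

/-- Prime avoidance for cosets: if no prime in the finite set `S` contains both `x` and `J`, then
some element of `x + J` avoids every prime in `S`. -/
theorem Ideal.exists_add_notMem_of_finite {R : Type*} [CommRing R] (x : R) (J : Ideal R)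
    (S : Finset (Ideal R)) (hS : ∀ p ∈ S, p.IsPrime) (h : ∀ p ∈ S, x ∈ p → ¬ J ≤ p) :
    ∃ a ∈ J, ∀ p ∈ S, x + a ∉ p := by
  classical
  induction S using Finset.strongInduction with
  | H S ih =>
    rcases S.eq_empty_or_nonempty with rfl | hne
    · exact ⟨0, J.zero_mem, by simp⟩
    -- a minimal prime `p` of `S` contains no other member of `S`, so an element that lies in `J`
    -- and in all the other primes, but not in `p`, can correct a solution for `S.erase p`
    obtain ⟨p, hp⟩ := S.exists_minimal hne
    have hpp := hS p hp.1
    obtain ⟨a, haJ, ha⟩ := ih (S.erase p) (Finset.erase_ssubset hp.1)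
      (fun q hq ↦ hS q (Finset.mem_of_mem_erase hq)) (fun q hq ↦ h q (Finset.mem_of_mem_erase hq))
    by_cases hxa : x + a ∈ p
    · have hJ : ¬ J ≤ p := fun hJ ↦ h p hp.1 ((p.add_mem_iff_left (hJ haJ)).mp hxa) hJ
      have hprod : ¬ (S.erase p).inf id ≤ p := by
        intro hle
        obtain ⟨q, hq, hqp⟩ := (hpp.inf_le' (f := id)).mp hle
        exact Finset.ne_of_mem_erase hq
          (le_antisymm hqp (hp.2 (Finset.mem_of_mem_erase hq) hqp))
      obtain ⟨b, hbJ, hb⟩ := SetLike.not_le_iff_exists.mp hJ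
      obtain ⟨c, hc, hcp⟩ := SetLike.not_le_iff_exists.mp hprod
      refine ⟨a + b * c, J.add_mem haJ (J.mul_mem_right c hbJ), fun q hq ↦ ?_⟩
      rw [← add_assoc]
      by_cases hqp : q = p
      · subst hqp
        rw [Ideal.add_mem_iff_right _ hxa]
        exact hpp.mul_notMem hb hcp
      · have hq' := Finset.mem_erase.mpr ⟨hqp, hq⟩
        have hcq : c ∈ q := (Finset.inf_le (f := id) hq') hc
        rw [Ideal.add_mem_iff_left _ (q.mul_mem_left b hcq)]
        exact ha q hq'
    · refine ⟨a, haJ, fun q hq ↦ ?_⟩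
      by_cases hqp : q = p
      · exact hqp ▸ hxa
      · exact ha q (Finset.mem_erase.mpr ⟨hqp, hq⟩)

section

variable {R : Type u} [CommRing R] {M : Type v} [AddCommGroup M] [Module R M]

/-! ### Changing the first term of a regular sequence, and depth -/

theorem RingTheory.Sequence.IsWeaklyRegular.of_subsingleton [Subsingleton M] (rs : List R) :
    IsWeaklyRegular M rs := by
  refine ⟨fun i _ ↦ ?_⟩
  have : Subsingleton (M ⧸ (Ideal.ofList (rs.take i) • ⊤ : Submodule R M)) :=
    (Submodule.mkQ_surjective _).subsingleton
  exact Function.injective_of_subsingleton _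

theorem Ideal.ofList_cons_eq_of_sub_mem {x y : R} {rs : List R} (h : y - x ∈ Ideal.ofList rs) :
    Ideal.ofList (y :: rs) = Ideal.ofList (x :: rs) := by
  have key : ∀ {a b : R}, b - a ∈ Ideal.ofList rs →
      Ideal.ofList (b :: rs) ≤ Ideal.ofList (a :: rs) := by
    intro a b hab
    simp only [Ideal.ofList_cons, sup_le_iff, le_sup_right, and_true, Ideal.span_le,
      Set.singleton_subset_iff, SetLike.mem_coe]
    have := Ideal.add_mem _ (Ideal.mem_sup_right hab : _ ∈ Ideal.span {a} ⊔ Ideal.ofList rs)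
      (Ideal.mem_sup_left (Ideal.mem_span_singleton_self a))
    simpa using this
  exact le_antisymm (key h) (key (by rw [← neg_sub]; exact neg_mem h))

theorem IsSMulRegular.quotient_ofList_congr {x y : R} {rs : List R} (h : y - x ∈ Ideal.ofList rs)
    (hx : IsSMulRegular (M ⧸ (Ideal.ofList rs • ⊤ : Submodule R M)) x) :
    IsSMulRegular (M ⧸ (Ideal.ofList rs • ⊤ : Submodule R M)) y := by
  have key : ∀ z : M ⧸ (Ideal.ofList rs • ⊤ : Submodule R M), y • z = x • z := by
    intro z
    obtain ⟨z, rfl⟩ := Submodule.Quotient.mk_surjective _ z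
    rw [← sub_eq_zero, ← sub_smul, ← Submodule.Quotient.mk_smul, Submodule.Quotient.mk_eq_zero]
    exact Submodule.smul_mem_smul h trivial
  intro a b hab
  exact hx (by simpa [key] using hab)

/-- Over a local ring, the first term of a weakly regular sequence may be changed by an element of
the ideal generated by the others: the sequence is permutable, and in the last position only the
class modulo the other terms matters. -/
theorem IsLocalRing.isWeaklyRegular_cons_of_sub_mem [IsLocalRing R] [IsNoetherian R M]
    {x y : R} {rs : List R} (hx : x ∈ maximalIdeal R) (hrs : ∀ r ∈ rs, r ∈ maximalIdeal R)
    (h : y - x ∈ Ideal.ofList rs) (hreg : IsWeaklyRegular M (x :: rs)) :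
    IsWeaklyRegular M (y :: rs) := by
  have hy : y ∈ maximalIdeal R := by
    have := add_mem ((Ideal.span_le.mpr hrs : Ideal.ofList rs ≤ maximalIdeal R) h) hx
    simpa using this
  have h1 : IsWeaklyRegular M (rs ++ [x]) :=
    isWeaklyRegular_of_perm_of_subset_maximalIdeal hreg (List.perm_append_singleton x rs).symm
      (by simpa using ⟨hx, hrs⟩)
  rw [isWeaklyRegular_append_iff, isWeaklyRegular_singleton_iff] at h1
  have h2 : IsWeaklyRegular M (rs ++ [y]) := by
    rw [isWeaklyRegular_append_iff, isWeaklyRegular_singleton_iff]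
    exact ⟨h1.1, h1.2.quotient_ofList_congr h⟩
  refine isWeaklyRegular_of_perm_of_subset_maximalIdeal h2 (List.perm_append_singleton y rs) ?_
  intro r hr
  rcases List.mem_append.mp hr with hr | hr
  · exact hrs r hr
  · rw [List.mem_singleton.mp hr]; exact hy

open CategoryTheory Abelian Limits ModuleCat in
/-- Dividing by a regular element lowers the depth by at most one. By Rees' theorem depth at least
`n + 1` means that `Ext i` from the residue field vanishes for `i < n + 1`, and the long exact
sequence of `0 → M → M → M / yM → 0` gives the vanishing for the quotient when `i < n`. -/
theorem ModuleCat.exists_isRegular_quotSMulTop [Small.{v} R] [IsNoetherianRing R] [IsLocalRing R]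
    (M : ModuleCat.{v} R) [Module.Finite R M] [Nontrivial M] {y : R} (hy : y ∈ maximalIdeal R)
    (hreg : IsSMulRegular M y) {n : ℕ} {rs : List R} (hlen : rs.length = n + 1)
    (hrs : ∀ r ∈ rs, r ∈ maximalIdeal R) (h : IsRegular M rs) :
    ∃ ss : List R, ss.length = n ∧ (∀ r ∈ ss, r ∈ maximalIdeal R) ∧
      IsRegular (QuotSMulTop y M) ss := by
  have hlt : ∀ (L : Type v) [AddCommGroup L] [Module R L] [Module.Finite R L] [Nontrivial L],
      maximalIdeal R • (⊤ : Submodule R L) < ⊤ := fun L _ _ _ _ ↦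
    (Submodule.top_ne_ideal_smul_of_le_jacobson_annihilator
      (maximalIdeal_le_jacobson _)).symm.lt_top
  have hsupp : Module.support R (Shrink.{v} (R ⧸ maximalIdeal R)) =
      PrimeSpectrum.zeroLocus (maximalIdeal R) := by
    rw [(Shrink.linearEquiv R _).support_eq, Module.support_eq_zeroLocus,
      Ideal.annihilator_quotient]
  have : Module.Finite R (Shrink.{v} (R ⧸ maximalIdeal R)) :=
    Module.Finite.equiv (Shrink.linearEquiv R (R ⧸ maximalIdeal R)).symm
  let K : ModuleCat.{v} R := ModuleCat.of R (Shrink.{v} (R ⧸ maximalIdeal R))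
  have hext : ∀ i < n + 1, Subsingleton (Ext K M i) := fun i hi ↦
    subsingleton_ext_of_exists_isRegular (maximalIdeal R) K hsupp.subset M (hlt M) rs hrs h i
      (hi.trans_eq hlen.symm)
  have : Nontrivial (QuotSMulTop y M) := nontrivial_quotSMulTop_of_mem_maximalIdeal M hy
  refine exists_isRegular_of_exists_subsingleton_ext (maximalIdeal R) n
    (ModuleCat.of R (QuotSMulTop y M)) (hlt _) K hsupp fun i hi ↦ ?_
  have zero1 := AddCommGrpCat.isZero_of_iff_subsingleton.mpr (hext i (by omega))
  have zero2 := AddCommGrpCat.isZero_of_iff_subsingleton.mpr (hext (i + 1) (by omega))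
  exact AddCommGrpCat.subsingleton_of_isZero <| ShortComplex.Exact.isZero_of_both_zeros
    ((Ext.covariant_sequence_exact₃' K hreg.smulShortComplex_shortExact) i (i + 1) rfl)
    (zero1.eq_zero_of_src _) (zero2.eq_zero_of_tgt _)

/-- The unbundled form of `ModuleCat.exists_isRegular_quotSMulTop`, with no restriction on the
universe of `M` and allowing `M = 0`. -/
theorem IsLocalRing.exists_isWeaklyRegular_quotSMulTop [IsNoetherianRing R] [IsLocalRing R]
    [Module.Finite R M] {y : R} (hy : y ∈ maximalIdeal R) (hreg : IsSMulRegular M y)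
    {n : ℕ} {rs : List R} (hlen : rs.length = n + 1)
    (hrs : ∀ r ∈ rs, r ∈ maximalIdeal R) (h : IsWeaklyRegular M rs) :
    ∃ ss : List R, ss.length = n ∧ (∀ r ∈ ss, r ∈ maximalIdeal R) ∧
      IsWeaklyRegular (QuotSMulTop y M) ss := by
  rcases subsingleton_or_nontrivial M with hM | hM
  · have : Subsingleton (QuotSMulTop y M) := (Submodule.mkQ_surjective _).subsingleton
    exact ⟨List.replicate n 0, by simp, fun r hr ↦ by simp [List.eq_of_mem_replicate hr],
      .of_subsingleton _⟩
  let e : ULift.{u} M ≃ₗ[R] M := ULift.moduleEquiv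
  have : Module.Finite R (ULift.{u} M) := Module.Finite.equiv e.symm
  obtain ⟨ss, h1, h2, h3⟩ := ModuleCat.exists_isRegular_quotSMulTop
    (ModuleCat.of R (ULift.{u} M)) hy ((e.isSMulRegular_congr y).mpr hreg) hlen hrs
    (IsRegular.of_isWeaklyRegular_of_mem_maximalIdeal _ hrs ((e.isWeaklyRegular_congr rs).mpr h))
  exact ⟨ss, h1, h2, ((QuotSMulTop.congr y e).isWeaklyRegular_congr ss).mp h3.toIsWeaklyRegular⟩

/-! ### Associated primes and torsion at the closed point -/

theorem IsAssociatedPrime.not_isSMulRegular [IsNoetherianRing R] {p : Ideal R}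
    (hp : p ∈ associatedPrimes R M) {r : R} (hr : r ∈ p) : ¬ IsSMulRegular M r := by
  have := Set.mem_biUnion (t := fun p : Ideal R ↦ (p : Set R)) hp hr
  rw [biUnion_associatedPrimes_eq_compl_regular] at this
  exact this

theorem isSMulRegular_of_forall_notMem [IsNoetherianRing R] {r : R}
    (h : ∀ p ∈ associatedPrimes R M, r ∉ p) : IsSMulRegular M r := by
  by_contra hr
  have : r ∈ {r : R | IsSMulRegular M r}ᶜ := hr
  rw [← biUnion_associatedPrimes_eq_compl_regular] at this
  obtain ⟨p, hp, hrp⟩ := Set.mem_iUnion₂.mp this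
  exact h p hp hrp

theorem IsAssociatedPrime.not_isSMulRegular_tensorProduct [IsNoetherianRing R] {p : Ideal R}
    [p.IsPrime] (hp : p ∈ associatedPrimes R M) {r : R} (hr : r ∈ p) :
    ¬ IsSMulRegular (Localization.AtPrime p ⊗[R] M) r := by
  intro hreg
  obtain ⟨-, x, hx⟩ := isAssociatedPrime_iff.mp hp
  have hloc : IsLocalizedModule p.primeCompl
      (TensorProduct.mk R (Localization.AtPrime p) M 1) :=
    (isLocalizedModule_iff_isBaseChange p.primeCompl (Localization.AtPrime p) _).mpr
      (TensorProduct.isBaseChange R M _)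
  have hrx : r • x = 0 := by
    rw [hx] at hr
    simpa [Submodule.mem_colon_singleton] using hr
  have h0 : TensorProduct.mk R (Localization.AtPrime p) M 1 x = 0 := by
    refine hreg.right_eq_zero_of_smul ?_
    rw [← map_smul, hrx, map_zero]
  obtain ⟨s, hs⟩ := (IsLocalizedModule.eq_zero_iff p.primeCompl _).mp h0
  have : (s : R) ∈ (⊥ : Submodule R M).colon {x} := by
    simpa [Submodule.mem_colon_singleton, ← Submonoid.smul_def] using hs
  rw [← hx] at this
  exact s.2 this

/-- A module of positive depth has no non-zero element killed by a power of the maximal ideal. -/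
theorem IsLocalRing.eq_zero_of_maximalIdeal_pow_smul_eq_zero [IsNoetherianRing R] [IsLocalRing R]
    (h : maximalIdeal R ∉ associatedPrimes R M) (n : ℕ) {x : M}
    (hx : ∀ a ∈ maximalIdeal R ^ n, a • x = 0) : x = 0 := by
  induction n generalizing x with
  | zero => simpa using hx 1 (by simp)
  | succ n ih =>
    refine ih fun a ha ↦ ?_
    by_contra hax
    refine h (isAssociatedPrime_iff.mpr ⟨inferInstance, a • x, ?_⟩)
    refine (maximalIdeal.isMaximal R).eq_of_le ?_ fun b hb ↦ ?_
    · intro htop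
      have : (1 : R) ∈ (⊥ : Submodule R M).colon {a • x} := htop ▸ trivial
      exact hax (by simpa [Submodule.mem_colon_singleton] using this)
    · rw [Submodule.mem_colon_singleton, smul_smul, Submodule.mem_bot, mul_comm]
      exact hx _ (by rw [pow_succ]; exact Ideal.mul_mem_mul ha hb)

/-- A finitely generated module has a submodule, killed by a power of the maximal ideal, whose
quotient has positive depth (or is zero): the largest submodule of this kind. -/
theorem IsLocalRing.exists_submodule_maximalIdeal_pow_torsion [IsNoetherianRing R] [IsLocalRing R]
    [Module.Finite R M] :
    ∃ (N : Submodule R M) (n : ℕ), (∀ x ∈ N, ∀ a ∈ maximalIdeal R ^ n, a • x = 0) ∧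
      maximalIdeal R ∉ associatedPrimes R (M ⧸ N) := by
  let T : ℕ →o Submodule R M :=
    ⟨fun n ↦ Submodule.torsionBySet R M (maximalIdeal R ^ n : Ideal R), fun m n hmn ↦
      Submodule.torsionBySet_le_torsionBySet_of_subset (Ideal.pow_le_pow_right hmn)⟩
  have hT : ∀ {n : ℕ} {x : M}, x ∈ T n ↔ ∀ a ∈ maximalIdeal R ^ n, a • x = 0 := by
    intro n x
    exact (Submodule.mem_torsionBySet_iff _ _).trans ⟨fun h a ha ↦ h ⟨a, ha⟩, fun h a ↦ h a a.2⟩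
  -- where the chain of the `𝔪 ^ n`-torsion submodules stabilizes, an element `x` with `𝔪 x ⊆ T n`
  -- lies in `T (n + 1) = T n`
  obtain ⟨n, hn⟩ := monotone_stabilizes_iff_noetherian.mpr (inferInstanceAs (IsNoetherian R M)) T
  refine ⟨T n, n, fun x hx ↦ hT.mp hx, fun hass ↦ ?_⟩
  obtain ⟨-, x, hx⟩ := isAssociatedPrime_iff.mp hass
  obtain ⟨x, rfl⟩ := Submodule.Quotient.mk_surjective _ x
  have hmx : ∀ b ∈ maximalIdeal R, b • x ∈ T n := by
    intro b hb
    rw [hx, Submodule.mem_colon_singleton, Submodule.mem_bot, ← Submodule.Quotient.mk_smul,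
      Submodule.Quotient.mk_eq_zero] at hb
    exact hb
  have hxT : x ∈ T (n + 1) := by
    refine hT.mpr fun a ha ↦ ?_
    rw [pow_succ] at ha
    refine Submodule.mul_induction_on ha (fun a ha b hb ↦ ?_) fun a b ha hb ↦ ?_
    · rw [mul_smul]
      exact hT.mp (hmx b hb) a ha
    · rw [add_smul, ha, hb, add_zero]
  rw [← hn (n + 1) n.le_succ] at hxT
  rw [(Submodule.Quotient.mk_eq_zero (T n)).mpr hxT] at hx
  refine (maximalIdeal.isMaximal R).ne_top (hx.trans ?_)
  simp

/-! ### Regularity on the punctured spectrum of a local ring -/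

section

/-- If `M` is killed by an element outside `q`, then its localization at `q` vanishes. -/
theorem subsingleton_tensorProduct_atPrime {q : Ideal R} [q.IsPrime] {s : R} (hs : s ∉ q)
    (h : ∀ x : M, s • x = 0) : Subsingleton (Localization.AtPrime q ⊗[R] M) := by
  refine subsingleton_of_forall_eq 0 fun z ↦ ?_
  have hz : s • z = 0 := by
    induction z with
    | zero => simp
    | tmul a x => rw [← TensorProduct.tmul_smul, h, TensorProduct.tmul_zero]
    | add a b ha hb => rw [smul_add, ha, hb, add_zero]
  have hu : IsUnit (algebraMap R (Localization.AtPrime q) s) :=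
    IsLocalization.map_units (M := q.primeCompl) _ ⟨s, hs⟩
  rw [← algebraMap_smul (Localization.AtPrime q)] at hz
  exact hu.smul_eq_zero.mp hz

/-- The sequence `rs` is weakly regular on the localization of `M` at every prime other than the
closed point of `Spec R` that contains all of its terms. The localization is taken as a tensor
product, which commutes visibly with quotients, and `rs` acts on it as a sequence in `R`. -/
def IsWeaklyRegularOnPunctured (R : Type u) [CommRing R] [IsLocalRing R] (M : Type v)
    [AddCommGroup M] [Module R M] (rs : List R) : Prop :=
  ∀ (q : Ideal R) [q.IsPrime], Ideal.ofList rs ≤ q → q ≠ maximalIdeal R →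
    IsWeaklyRegular (Localization.AtPrime q ⊗[R] M) rs

variable [IsLocalRing R]

/-- Dividing out a submodule supported at the closed point does not affect the punctured
spectrum. -/
theorem IsWeaklyRegularOnPunctured.quotient_of_torsion {rs : List R}
    (h : IsWeaklyRegularOnPunctured R M rs) {N : Submodule R M} {n : ℕ}
    (hN : ∀ x ∈ N, ∀ a ∈ maximalIdeal R ^ n, a • x = 0) :
    IsWeaklyRegularOnPunctured R (M ⧸ N) rs := by
  intro q hq hle hne
  obtain ⟨s, hs, hsq⟩ : ∃ s ∈ maximalIdeal R, s ∉ q :=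
    SetLike.not_le_iff_exists.mp fun hle' ↦
      hne (le_antisymm (le_maximalIdeal hq.ne_top) hle')
  have hsub : Subsingleton (Localization.AtPrime q ⊗[R] N) :=
    subsingleton_tensorProduct_atPrime (s := s ^ n) (fun h ↦ hsq (hq.mem_of_pow_mem n h))
      fun x ↦ Subtype.ext (hN x x.2 _ (Ideal.pow_mem_pow hs n))
  have hex := lTensor_exact (Localization.AtPrime q) (LinearMap.exact_subtype_mkQ N)
    N.mkQ_surjective
  have hbij : Function.Bijective (N.mkQ.lTensor (Localization.AtPrime q)) := by
    refine ⟨(injective_iff_map_eq_zero _).mpr fun z hz ↦ ?_,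
      LinearMap.lTensor_surjective _ N.mkQ_surjective⟩
    obtain ⟨w, rfl⟩ := (hex z).mp hz
    rw [Subsingleton.elim w 0, map_zero]
  exact ((LinearEquiv.ofBijective _ hbij).isWeaklyRegular_congr rs).mp (h q hle hne)

/-- Regularity on the punctured spectrum passes to `M / yM`, where `x` may first be replaced by
`y ∈ x + (rs)`: at a prime containing `(y, rs) = (x, rs)` the two sequences are equivalent. -/
theorem IsWeaklyRegularOnPunctured.quotSMulTop [IsNoetherianRing R] [Module.Finite R M]
    {x y : R} {rs : List R} (hxy : y - x ∈ Ideal.ofList rs)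
    (h : IsWeaklyRegularOnPunctured R M (x :: rs)) :
    IsWeaklyRegularOnPunctured R (QuotSMulTop y M) rs := by
  intro q hq hle hne
  by_cases hyq : y ∈ q
  · have hxq : x ∈ q := by simpa using sub_mem hyq (hle hxy)
    have hreg := h q (by simpa using ⟨hxq, hle⟩) hne
    rw [← isWeaklyRegular_map_algebraMap_iff (Localization.AtPrime q)] at hreg
    have hmem : ∀ {r : R}, r ∈ q →
        algebraMap R (Localization.AtPrime q) r ∈ maximalIdeal (Localization.AtPrime q) :=
      fun hr ↦ (IsLocalization.AtPrime.to_map_mem_maximal_iff _ q _).mpr hr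
    have hreg' := isWeaklyRegular_cons_of_sub_mem
      (y := algebraMap R (Localization.AtPrime q) y) (hmem hxq)
      (fun r hr ↦ by
        obtain ⟨r', hr', rfl⟩ := List.mem_map.mp hr
        exact hmem (hle (Ideal.subset_span hr')))
      (by rw [← map_sub, ← Ideal.map_ofList]; exact Ideal.mem_map_of_mem _ hxy) hreg
    rw [← List.map_cons, isWeaklyRegular_map_algebraMap_iff, isWeaklyRegular_cons_iff] at hreg'
    exact ((QuotSMulTop.tensorQuotSMulTopEquivQuotSMulTop y (Localization.AtPrime q)
      M).isWeaklyRegular_congr rs).mpr hreg'.2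
  -- a prime containing `rs` but not `y` lies outside the support of `M / yM`
  · have := subsingleton_tensorProduct_atPrime (M := QuotSMulTop y M) hyq fun z ↦
      Module.mem_annihilator.mp (QuotSMulTop.mem_annihilator M y) z
    exact .of_subsingleton _

variable [IsNoetherianRing R] [Module.Finite R M]

/-- If `x :: rs` is weakly regular on the punctured spectrum and the closed point is not
associated to `M`, then `x` can be modified by an element of `(rs)` to become regular on `M`: away
from the closed point no prime containing the sequence is associated to `M`. -/
theorem IsWeaklyRegularOnPunctured.exists_isSMulRegular {x : R} {rs : List R}
    (h : IsWeaklyRegularOnPunctured R M (x :: rs))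
    (hM : maximalIdeal R ∉ associatedPrimes R M) :
    ∃ y : R, y - x ∈ Ideal.ofList rs ∧ IsSMulRegular M y := by
  have hfin := associatedPrimes.finite R M
  obtain ⟨a, ha, hS⟩ := Ideal.exists_add_notMem_of_finite x (Ideal.ofList rs) hfin.toFinset
    (fun p hp ↦ ((hfin.mem_toFinset).mp hp).1) fun p hp hxp hle ↦ by
      have hp' := (hfin.mem_toFinset).mp hp
      have := hp'.isPrime
      refine IsAssociatedPrime.not_isSMulRegular_tensorProduct hp' hxp
        ((isWeaklyRegular_cons_iff _ _ _).mp (h p ?_ ?_)).1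
      · simpa using ⟨hxp, hle⟩
      · rintro rfl
        exact hM hp'
  exact ⟨x + a, by simpa using ha,
    isSMulRegular_of_forall_notMem fun p hp ↦ hS p (hfin.mem_toFinset.mpr hp)⟩

/-- If `rs` is weakly regular on `M / N`, then `N / rs N` embeds into `M / rs M`. If moreover
`N ⊆ rs M`, this embedding is zero, so that `N = 0` by Nakayama's lemma. -/
theorem Submodule.eq_bot_of_isWeaklyRegular_quotient {rs : List R}
    (hrs : ∀ r ∈ rs, r ∈ maximalIdeal R) {N : Submodule R M}
    (hN : N ≤ Ideal.ofList rs • ⊤) (h : IsWeaklyRegular (M ⧸ N) rs) : N = ⊥ := by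
  have hex := map_first_exact_on_four_term_right_exact_of_isSMulRegular_last
    (f₁ := (0 : N →ₗ[R] N)) (f₂ := N.subtype) (f₃ := N.mkQ)
    ((LinearMap.exact_zero_iff_injective N _).mpr N.injective_subtype)
    (LinearMap.exact_subtype_mkQ N) N.mkQ_surjective h
  have htop : (⊤ : Submodule R N) ≤ Ideal.ofList rs • ⊤ := by
    intro x _
    have hx : Submodule.mapQ _ _ _
        (Submodule.smul_top_le_comap_smul_top (Ideal.ofList rs) N.subtype)
        (Submodule.Quotient.mk x) = 0 := by
      rw [Submodule.mapQ_apply, Submodule.Quotient.mk_eq_zero]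
      exact hN x.2
    obtain ⟨z, hz⟩ := (hex _).mp hx
    obtain ⟨z, rfl⟩ := Submodule.Quotient.mk_surjective _ z
    rw [Submodule.mapQ_apply, LinearMap.zero_apply, eq_comm, Submodule.Quotient.mk_zero,
      Submodule.Quotient.mk_eq_zero] at hz
    exact hz
  have hbot := Submodule.eq_bot_of_le_smul_of_le_jacobson_bot (Ideal.ofList rs) ⊤
    Module.Finite.fg_top htop ((Ideal.span_le.mpr hrs).trans (maximalIdeal_le_jacobson _))
  have : Subsingleton N := (Submodule.subsingleton_iff R).mp (subsingleton_of_bot_eq_top hbot.symm)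
  exact Submodule.subsingleton_iff_eq_bot.mp this

/-- The local heart of the argument: a sequence that is weakly regular on the punctured spectrum is
weakly regular, provided that `M` has depth at least the length of the sequence in case the closed
point is associated to `M / rs M`. -/
theorem IsWeaklyRegularOnPunctured.isWeaklyRegular {rs : List R}
    (hrs : ∀ r ∈ rs, r ∈ maximalIdeal R) (h : IsWeaklyRegularOnPunctured R M rs)
    (hdepth : maximalIdeal R ∈ associatedPrimes R (M ⧸ (Ideal.ofList rs • ⊤ : Submodule R M)) →
      ∃ ss : List R, ss.length = rs.length ∧ (∀ r ∈ ss, r ∈ maximalIdeal R) ∧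
        IsWeaklyRegular M ss) :
    IsWeaklyRegular M rs := by
  induction rs generalizing M with
  | nil => exact .nil R M
  | cons x rs ih =>
    obtain ⟨hx, hrs'⟩ := List.forall_mem_cons.mp hrs
    -- If the closed point is not associated to the module, replace `x` by a regular element `y`
    -- with `(y, rs) = (x, rs)` and divide by `y`. This is needed both for `M` and for a quotient.
    have key : ∀ {L : Type v} [AddCommGroup L] [Module R L] [Module.Finite R L],
        IsWeaklyRegularOnPunctured R L (x :: rs) →
        (maximalIdeal R ∈ associatedPrimes R
            (L ⧸ (Ideal.ofList (x :: rs) • ⊤ : Submodule R L)) →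
          ∃ ss : List R, ss.length = (x :: rs).length ∧ (∀ r ∈ ss, r ∈ maximalIdeal R) ∧
            IsWeaklyRegular L ss) →
        maximalIdeal R ∉ associatedPrimes R L → IsWeaklyRegular L (x :: rs) := by
      intro L _ _ _ h hdepth hL
      obtain ⟨y, hyx, hy⟩ := h.exists_isSMulRegular hL
      have hym : y ∈ maximalIdeal R := by
        simpa using add_mem ((Ideal.span_le.mpr hrs' : Ideal.ofList rs ≤ maximalIdeal R) hyx) hx
      have hreg : IsWeaklyRegular (QuotSMulTop y L) rs := by
        refine ih hrs' (h.quotSMulTop hyx) fun hass ↦ ?_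
        obtain ⟨ss, hlen, hss, hreg⟩ := hdepth <| by
          rw [← Ideal.ofList_cons_eq_of_sub_mem hyx]
          exact (Submodule.quotOfListConsSMulTopEquivQuotSMulTopInner L y
            rs).isAssociatedPrime_iff.mpr hass
        exact exists_isWeaklyRegular_quotSMulTop hym hy hlen hss hreg
      exact isWeaklyRegular_cons_of_sub_mem hym hrs' (by rw [← neg_sub]; exact neg_mem hyx)
        (.cons hy hreg)
    by_cases hass : maximalIdeal R ∈
        associatedPrimes R (M ⧸ (Ideal.ofList (x :: rs) • ⊤ : Submodule R M))
    · refine key h hdepth fun hM ↦ ?_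
      obtain ⟨_ | ⟨y, ss⟩, hlen, hss, hreg⟩ := hdepth hass
      · simp at hlen
      · exact IsAssociatedPrime.not_isSMulRegular hM (hss y List.mem_cons_self)
          ((isWeaklyRegular_cons_iff M y ss).mp hreg).1
    -- `key` applies to the quotient by the torsion `N` at the closed point; as `M / (x, rs) M` has
    -- no such torsion, `N ⊆ (x, rs) M`, and this forces `N = 0`
    · obtain ⟨N, n, hN, hMN⟩ := exists_submodule_maximalIdeal_pow_torsion (R := R) (M := M)
      have hle : N ≤ Ideal.ofList (x :: rs) • ⊤ := fun z hz ↦ by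
        rw [← Submodule.Quotient.mk_eq_zero]
        refine eq_zero_of_maximalIdeal_pow_smul_eq_zero hass n fun a ha ↦ ?_
        rw [← Submodule.Quotient.mk_smul, hN z hz a ha, Submodule.Quotient.mk_zero]
      let I := Ideal.ofList (x :: rs)
      let e : ((M ⧸ N) ⧸ (I • ⊤ : Submodule R (M ⧸ N))) ≃ₗ[R] M ⧸ (I • ⊤ : Submodule R M) :=
        Submodule.quotEquivOfEq _ _ (by rw [Submodule.map_smul'', Submodule.map_top,
          Submodule.range_mkQ]) ≪≫ₗ Submodule.quotientQuotientEquivQuotient N (I • ⊤) hle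
      have hreg := key (h.quotient_of_torsion hN)
        (fun hass' ↦ (hass (e.isAssociatedPrime_iff.mp hass')).elim) hMN
      have hN0 := Submodule.eq_bot_of_isWeaklyRegular_quotient hrs hle hreg
      exact ((Submodule.quotEquivOfEqBot N hN0).isWeaklyRegular_congr _).mp hreg

end

/-! ### Depth and localization -/

theorem RingTheory.Sequence.IsWeaklyRegular.take {rs : List R} (h : IsWeaklyRegular M rs) (n : ℕ) :
    IsWeaklyRegular M (rs.take n) := by
  rw [← List.take_append_drop n rs, isWeaklyRegular_append_iff] at h
  exact h.1

theorem RingTheory.Sequence.IsWeaklyRegular.isRegularSeq {rs : List R}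
    (h : IsWeaklyRegular M rs) : IsRegularSeq R M rs := fun p _ ↦
  h.of_isLocalizedModule _ p.asIdeal.primeCompl (LocalizedModule.mkLinearMap _ M)

/-- Over a local ring, the closed point lies in the support of `M / rs M` as soon as `M ≠ 0`, and
localizing there changes nothing. -/
theorem IsRegularSeq.isWeaklyRegular [IsLocalRing R] [Module.Finite R M] {rs : List R}
    (hrs : ∀ r ∈ rs, r ∈ maximalIdeal R) (h : IsRegularSeq R M rs) : IsWeaklyRegular M rs := by
  rcases subsingleton_or_nontrivial M with hM | hM
  · exact .of_subsingleton _
  let S := (closedPoint R).asIdeal.primeCompl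
  have hS : S ≤ IsUnit.submonoid R := fun s hs ↦ not_not.mp hs
  have : Nontrivial (M ⧸ (Ideal.ofList rs • ⊤ : Submodule R M)) :=
    Submodule.Quotient.nontrivial_iff.mpr
      (Submodule.top_ne_ideal_smul_of_le_jacobson_annihilator
        ((Ideal.span_le.mpr hrs).trans (maximalIdeal_le_jacobson _))).symm
  obtain ⟨p, hp⟩ := Module.nonempty_support_of_nontrivial (R := R)
    (M := M ⧸ (Ideal.ofList rs • ⊤ : Submodule R M))
  have hreg := h (closedPoint R)
    (Module.mem_support_mono (le_maximalIdeal p.isPrime.ne_top : p ≤ closedPoint R) hp)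
  rw [IsStronglyRegularSeq, isWeaklyRegular_map_algebraMap_iff] at hreg
  have : IsLocalization S R := IsLocalization.self hS
  have : IsLocalizedModule S (LinearMap.id : M →ₗ[R] M) := isLocalizedModule_id S M R
  exact ((IsLocalizedModule.linearEquiv S LinearMap.id
    (LocalizedModule.mkLinearMap S M)).isWeaklyRegular_congr rs).mpr hreg

/-- Truncating a longer sequence shows that depth at least `n` is witnessed by a weakly regular
sequence of length exactly `n`. No supremum of an unbounded set is at issue: it is taken in `ℕ∞`. -/
theorem natCast_le_localDepth_iff [IsLocalRing R] [Module.Finite R M] {n : ℕ} :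
    (n : ℕ∞) ≤ localDepth R M ↔ ∃ rs : List R, rs.length = n ∧ (∀ r ∈ rs, r ∈ maximalIdeal R) ∧
      IsWeaklyRegular M rs := by
  constructor
  · intro h
    cases n with
    | zero => exact ⟨[], rfl, by simp, .nil R M⟩
    | succ n =>
      obtain ⟨-, ⟨rs, hrs, hreg, rfl⟩, hlt⟩ := lt_sSup_iff.mp
        ((Nat.cast_lt (α := ℕ∞).mpr n.lt_succ_self).trans_le h)
      have hlen : n + 1 ≤ rs.length := Nat.cast_lt.mp hlt
      exact ⟨rs.take (n + 1), by simpa using hlen, fun r hr ↦ hrs r (List.mem_of_mem_take hr),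
        (hreg.isWeaklyRegular hrs).take _⟩
  · rintro ⟨rs, rfl, hrs, hreg⟩
    exact le_sSup ⟨rs, hrs, hreg.isRegularSeq, rfl⟩

theorem IsRegularSeq.length_le_localDepth [Module.Finite R M] {rs : List R}
    (h : IsRegularSeq R M rs) (p : PrimeSpectrum R)
    (hp : p ∈ Module.support R (M ⧸ (Ideal.ofList rs • ⊤ : Submodule R M))) :
    (rs.length : ℕ∞) ≤ localDepth (Localization.AtPrime p.asIdeal)
      (LocalizedModule p.asIdeal.primeCompl M) := by
  refine natCast_le_localDepth_iff.mpr ⟨_, List.length_map _, fun r hr ↦ ?_, h p hp⟩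
  obtain ⟨r', hr', rfl⟩ := List.mem_map.mp hr
  rw [Module.support_quotient] at hp
  exact (IsLocalization.AtPrime.to_map_mem_maximal_iff _ p.asIdeal _).mpr
    (hp.2 (Ideal.subset_span hr'))

/-- Transitivity of localization: for a prime `q` of `R_p`, the localization of `M_p` at `q` is that
of `M` at the contraction of `q`. -/
theorem isWeaklyRegular_tensorProduct_localizedModule {p : Ideal R} [p.IsPrime]
    (q : Ideal (Localization.AtPrime p)) [q.IsPrime] {rs : List R}
    (h : IsWeaklyRegular
      (LocalizedModule (q.comap (algebraMap R (Localization.AtPrime p))).primeCompl M) rs) :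
    IsWeaklyRegular
      (Localization.AtPrime q ⊗[Localization.AtPrime p] LocalizedModule p.primeCompl M)
      (rs.map (algebraMap R (Localization.AtPrime p))) := by
  let A := Localization.AtPrime p
  let T := Localization.AtPrime q
  let L := LocalizedModule p.primeCompl M
  have hT : IsLocalization.AtPrime T (q.comap (algebraMap R A)) :=
    IsLocalization.isLocalization_isLocalization_atPrime_isLocalization p.primeCompl T q
  have hL : IsBaseChange A (LocalizedModule.mkLinearMap p.primeCompl M) :=
    (isLocalizedModule_iff_isBaseChange p.primeCompl A _).mp inferInstance
  have hTL := hL.comp (TensorProduct.isBaseChange A L T)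
  let g := ((TensorProduct.mk A T L 1).restrictScalars R).comp
    (LocalizedModule.mkLinearMap p.primeCompl M)
  have hg : IsLocalizedModule (q.comap (algebraMap R A)).primeCompl g :=
    (isLocalizedModule_iff_isBaseChange (q.comap (algebraMap R A)).primeCompl T _).mpr hTL
  rw [isWeaklyRegular_map_algebraMap_iff]
  exact ((IsLocalizedModule.linearEquiv (q.comap (algebraMap R A)).primeCompl
    (LocalizedModule.mkLinearMap _ M) g).isWeaklyRegular_congr rs).mp h

theorem mem_associatedPrimes_quotient_of_maximalIdeal_mem [IsNoetherianRing R] {p : Ideal R}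
    [p.IsPrime] {I : Ideal R}
    (h : maximalIdeal (Localization.AtPrime p) ∈ associatedPrimes (Localization.AtPrime p)
      (LocalizedModule p.primeCompl M ⧸
        (I.map (algebraMap R (Localization.AtPrime p)) • ⊤ :
          Submodule (Localization.AtPrime p) (LocalizedModule p.primeCompl M)))) :
    p ∈ associatedPrimes R (M ⧸ (I • ⊤ : Submodule R M)) := by
  have heq : I.map (algebraMap R (Localization.AtPrime p)) • ⊤ =
      (I • ⊤ : Submodule R M).localized p.primeCompl := by
    rw [Submodule.localized, Submodule.localized'_smul, Ideal.localized'_eq_map,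
      Submodule.localized'_top]
  open Module.associatedPrimes in
  rw [heq, ← preimage_comap_associatedPrimes_eq_associatedPrimes_of_isLocalizedModule
    p.primeCompl (Localization.AtPrime p)
    ((I • ⊤ : Submodule R M).toLocalizedQuotient p.primeCompl)] at h
  simpa [Localization.AtPrime.under_maximalIdeal] using h

/-- A bound on the depth at the associated primes of `M / rs M` suffices for weak regularity at
every prime containing `rs`. The induction is on the height of the prime: the inductive hypothesis says
that the sequence is weakly regular on the punctured spectrum of `R_p`. -/
theorem isWeaklyRegular_localizedModule_of_le_localDepth [IsNoetherianRing R] [Module.Finite R M]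
    {rs : List R}
    (h : ∀ p : PrimeSpectrum R,
      p.asIdeal ∈ associatedPrimes R (M ⧸ (Ideal.ofList rs • ⊤ : Submodule R M)) →
        (rs.length : ℕ∞) ≤ localDepth (Localization.AtPrime p.asIdeal)
          (LocalizedModule p.asIdeal.primeCompl M))
    (p : Ideal R) [hp : p.IsPrime] (hle : Ideal.ofList rs ≤ p) :
    IsWeaklyRegular (LocalizedModule p.primeCompl M) rs := by
  induction hn : p.height using WellFoundedLT.induction generalizing p with
  | ind n ih =>
  let A := Localization.AtPrime p
  rw [← isWeaklyRegular_map_algebraMap_iff A]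
  refine IsWeaklyRegularOnPunctured.isWeaklyRegular (fun r hr ↦ ?_) (fun q _ hq hne ↦ ?_) ?_
  · obtain ⟨r', hr', rfl⟩ := List.mem_map.mp hr
    exact (IsLocalization.AtPrime.to_map_mem_maximal_iff _ p _).mpr (hle (Ideal.subset_span hr'))
  · refine isWeaklyRegular_tensorProduct_localizedModule q (ih _ ?_ _ ?_ rfl)
    · rw [← hn]
      refine Ideal.height_strict_mono_of_isPrime_of_isPrime (lt_of_le_of_ne ?_ ?_)
      · conv_rhs => rw [← Localization.AtPrime.under_maximalIdeal (I := p)]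
        exact Ideal.comap_mono (le_maximalIdeal Ideal.IsPrime.ne_top')
      · intro heq
        refine hne (le_antisymm (le_maximalIdeal Ideal.IsPrime.ne_top') ?_)
        rw [← Localization.AtPrime.map_eq_maximalIdeal, Ideal.map_le_iff_le_comap]
        exact heq.ge
    · rwa [← Ideal.map_le_iff_le_comap, Ideal.map_ofList]
  · intro hass
    rw [← Ideal.map_ofList] at hass
    rw [List.length_map]
    exact natCast_le_localDepth_iff.mp
      (h ⟨p, hp⟩ (mem_associatedPrimes_quotient_of_maximalIdeal_mem hass))

end

theorem mainTheorem1 (R : Type u) [CommRing R] [IsNoetherianRing R]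
    (M : Type v) [AddCommGroup M] [Module R M] [Module.Finite R M] (f : List R) :
    List.TFAE [
      IsRegularSeq R M f,
      ∀ p : PrimeSpectrum R,
        p ∈ Module.support R (M ⧸ (Ideal.ofList f • ⊤ : Submodule R M)) →
          (f.length : ℕ∞) ≤ localDepth (Localization.AtPrime p.asIdeal)
            (LocalizedModule p.asIdeal.primeCompl M),
      ∀ p : PrimeSpectrum R,
        p.asIdeal ∈ associatedPrimes R (M ⧸ (Ideal.ofList f • ⊤ : Submodule R M)) →
          (f.length : ℕ∞) ≤ localDepth (Localization.AtPrime p.asIdeal)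
            (LocalizedModule p.asIdeal.primeCompl M)] := by
  tfae_have 1 → 2 := IsRegularSeq.length_le_localDepth
  tfae_have 2 → 3 := fun h p hp ↦ by
    -- associated primes lie in the support
    refine h p (Module.mem_support_iff_exists_annihilator.mpr ?_)
    obtain ⟨-, x, hx⟩ := isAssociatedPrime_iff.mp hp
    refine ⟨x, fun r hr ↦ ?_⟩
    rw [Submodule.mem_annihilator_span_singleton] at hr
    rw [hx, Submodule.mem_colon_singleton, hr]
    exact zero_mem _
  tfae_have 3 → 1 := fun h p hp ↦ by
    rw [Module.support_quotient] at hp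
    rw [IsStronglyRegularSeq, isWeaklyRegular_map_algebraMap_iff]
    exact isWeaklyRegular_localizedModule_of_le_localDepth h p.asIdeal hp.2
  tfae_finish
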